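/- Let $n\ge 1$ and $\gamma>0$, let $\mu$ be a probability distribution on an input space $\mathcal X$, let $U$ be a (measurable) map from $\mathcal X$ to the unitary group $\mathcal U(2^n)$ of $n$ qubits, and let $\rho_0$ be an $n$-qubit density matrix. Put $\rho(x)=U(x)\rho_0U(x)^\dagger$, and let $\rho_k(x)$ be the reduced state of $\rho(x)$ on the $k$-th qubit. The fidelity quantum kernel and the projected quantum kernel are $$\kappa^{FQ}(x,x')=\mathrm{Tr}[\rho(x)\rho(x')],\qquad \kappa^{PQ}(x,x')=\exp\Big(-\gamma\sum_{k=1}^n\|\rho_k(x)-\rho_k(x')\|_2^2\Big),$$ where $\|\cdot\|_p$ is the Schatten $p$-norm. Let $$\mathcal A_{\mathbb U}(\rho_0)=\int_{\mathcal U(2^n)}V^{\otimes 2}\rho_0^{\otimes 2}(V^\dagger)^{\otimes 2}\,dV-\mathbb E_{x\sim\mu}\big[U(x)^{\otimes 2}\rho_0^{\otimes 2}(U(x)^\dagger)^{\otimes 2}\big],\qquad \varepsilon=\|\mathcal A_{\mathbb U}(\rho_0)\|_1,$$ where $dV$ is the normalised Haar measure. Then for $x,x'$ drawn independently from $\mu$,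 for every $\delta>0$ and for each of the two kernels $\kappa$, $$\Pr_{x,x'}\big[\,|\kappa(x,x')-\mathbb E_{x,x'}[\kappa(x,x')]|\ge\delta\,\big]\le\frac{G_n(\varepsilon)}{\delta^2},$$ where 1. for the fidelity kernel $\kappa=\kappa^{FQ}$, $\;G_n(\varepsilon)=\beta_{\rm Haar}+\varepsilon\big(\varepsilon+2\sqrt{\beta_{\rm Haar}}\big)$ with $\beta_{\rm Haar}=\dfrac{1}{2^{n-1}(2^n+1)}$; 2. for the projected kernel $\kappa=\kappa^{PQ}$, $\;G_n(\varepsilon)=4\gamma n\big(\tilde\beta_{\rm Haar}+\varepsilon\big)$ with $\tilde\beta_{\rm Haar}=\dfrac{3}{2^{n+1}+2}$. -/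

import Mathlib

open MeasureTheory
open scoped Kronecker Matrix ComplexOrder

namespace QuantumKernel

/-- Labels of the computational basis of `n` qubits. -/
abbrev Bits (n : ℕ) : Type := Fin n → Fin 2

/-- Operators on the Hilbert space of `n` qubits, of dimension `2 ^ n`. -/
abbrev Op (n : ℕ) : Type := Matrix (Bits n) (Bits n) ℂ

/-- Operators on two copies of the Hilbert space of `n` qubits. -/
abbrev Op₂ (n : ℕ) : Type := Matrix (Bits n × Bits n) (Bits n × Bits n) ℂ

/-- The unitary group of the Hilbert space of `n` qubits. -/
abbrev UGroup (n : ℕ) : Type := Matrix.unitaryGroup (Bits n) ℂ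

/-- The unitary group carries its Borel σ-algebra. -/
noncomputable instance instMeasurableSpaceUGroup (n : ℕ) : MeasurableSpace (UGroup n) := borel _

instance instBorelSpaceUGroup (n : ℕ) : BorelSpace (UGroup n) := ⟨rfl⟩

instance instCompactSpaceUGroup (n : ℕ) : CompactSpace (UGroup n) := by
  have hK : IsCompact (Set.univ.pi fun _ : Bits n => Set.univ.pi fun _ : Bits n =>
      Metric.closedBall (0 : ℂ) 1) :=
    isCompact_univ_pi fun _ => isCompact_univ_pi fun _ => isCompact_closedBall 0 1
  have hC : IsClosed ((Matrix.unitaryGroup (Bits n) ℂ : Submonoid (Op n)) : Set (Op n)) :=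
    isClosed_unitary
  refine isCompact_iff_compactSpace.mp (hK.of_isClosed_subset hC ?_)
  intro V hV i _ j _
  simpa using entry_norm_bound_of_unitary hV i j

/-- A quantum state: a positive semidefinite operator of trace one (pure or mixed). -/
def IsState {n : ℕ} (ρ : Op n) : Prop := ρ.PosSemidef ∧ ρ.trace = 1

/-- The normalised Haar measure on the unitary group. -/
noncomputable def haar (n : ℕ) : Measure (UGroup n) := Measure.haarMeasure ⊤

/-- The average `∫ V^{⊗2} ρ^{⊗2} (V†)^{⊗2} dν(V)` over the unitaries distributed by `ν`,
taken entry by entry. -/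
noncomputable def twirl {n : ℕ} (ν : Measure (UGroup n)) (ρ : Op n) : Op₂ n :=
  Matrix.of fun i j => ∫ V : UGroup n,
    (((V : Op n) ⊗ₖ (V : Op n)) * (ρ ⊗ₖ ρ) * ((V : Op n)ᴴ ⊗ₖ (V : Op n)ᴴ)) i j ∂ν

/-- The deviation `𝒜(ρ)` of the ensemble `ν` of unitaries from a 2-design. -/
noncomputable def deviation {n : ℕ} (ν : Measure (UGroup n)) (ρ : Op n) : Op₂ n :=
  twirl (haar n) ρ - twirl ν ρ

/-- The trace norm (Schatten 1-norm): the sum of the singular values, which are the square roots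
of the eigenvalues of `A† A`. -/
noncomputable def traceNorm {ι : Type*} [Fintype ι] [DecidableEq ι] (A : Matrix ι ι ℂ) : ℝ :=
  ∑ i, √((Matrix.isHermitian_conjTranspose_mul_self A).eigenvalues i)

/-- The Schatten 2-norm `√(Tr (A† A))`. -/
noncomputable def schattenTwoNorm {ι : Type*} [Fintype ι] (A : Matrix ι ι ℂ) : ℝ :=
  √((Aᴴ * A).trace.re)

/-- The expressivity measure of the ensemble `ν` of unitaries for the initial state `ρ₀`. -/
noncomputable def expressivity {n : ℕ} (ν : Measure (UGroup n)) (ρ₀ : Op n) : ℝ :=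
  traceNorm (deviation ν ρ₀)

/-- The encoded state `U(x) ρ₀ U(x)†`. -/
def encode {𝒳 : Type*} {n : ℕ} (U : 𝒳 → UGroup n) (ρ₀ : Op n) (x : 𝒳) : Op n :=
  (U x : Op n) * ρ₀ * (U x : Op n)ᴴ

/-- The reduced state on the `k`-th qubit: its entry `(a, b)` is the sum of `ρ z w` over the pairs
`z`, `w` of basis labels that agree off `k` and have `z k = a`, `w k = b`. -/
def reduced {n : ℕ} (k : Fin n) (ρ : Op n) : Matrix (Fin 2) (Fin 2) ℂ :=
  Matrix.of fun a b => ∑ z : Bits n with z k = a, ρ z (Function.update z k b)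

/-- The fidelity quantum kernel `Tr[ρ(x) ρ(x')]`. -/
noncomputable def fidelityKernel {𝒳 : Type*} {n : ℕ} (U : 𝒳 → UGroup n) (ρ₀ : Op n)
    (x x' : 𝒳) : ℝ :=
  (encode U ρ₀ x * encode U ρ₀ x').trace.re

/-- The projected quantum kernel `exp (-γ ∑ₖ ‖ρₖ(x) - ρₖ(x')‖₂²)`. -/
noncomputable def projectedKernel {𝒳 : Type*} {n : ℕ} (γ : ℝ) (U : 𝒳 → UGroup n) (ρ₀ : Op n)
    (x x' : 𝒳) : ℝ :=
  Real.exp (-γ * ∑ k : Fin n,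
    schattenTwoNorm (reduced k (encode U ρ₀ x) - reduced k (encode U ρ₀ x')) ^ 2)

/-- The mean of a kernel over two independent inputs with law `μ`. -/
noncomputable def mean {𝒳 : Type*} [MeasurableSpace 𝒳] (μ : Measure 𝒳) (κ : 𝒳 → 𝒳 → ℝ) : ℝ :=
  ∫ p : 𝒳 × 𝒳, κ p.1 p.2 ∂(μ.prod μ)

/-- The probability, over two independent inputs with law `μ`, that a kernel deviates from its
mean by at least `δ`. -/
noncomputable def deviationProb {𝒳 : Type*} [MeasurableSpace 𝒳] (μ : Measure 𝒳)
    (κ : 𝒳 → 𝒳 → ℝ) (δ : ℝ) : ℝ :=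
  (μ.prod μ).real {p : 𝒳 × 𝒳 | δ ≤ |κ p.1 p.2 - mean μ κ|}

/-- `β_Haar = 1 / (2^(n-1) (2^n + 1))`, for `n ≥ 1`. -/
noncomputable def betaHaar (n : ℕ) : ℝ := 1 / (2 ^ (n - 1) * (2 ^ n + 1))

/-- `β̃_Haar = 3 / (2^(n+1) + 2)`. -/
noncomputable def betaTildeHaar (n : ℕ) : ℝ := 3 / (2 ^ (n + 1) + 2)

end QuantumKernel

open QuantumKernel

/-! Chebyshev reduces both bounds to a second moment. Write `d = 2 ^ n`, `P = Tr ρ²`, `M` for the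
twirl of `ρ` over the law of `U`, `H` for the Haar twirl, `𝒜 = H - M`.

Haar invariance makes `H` commute with every `W ⊗ W`, so `H = a • 1 + b • swap`
(`exists_eq_smul_one_add_smul_swapOp`), and the traces of `H` and `swap * H` determine `a` and `b`
(`twirl_haar_eq`). Those two traces are `1` and `P` for any twirl, hence `Tr (H * M) = Tr (H * H)`.

Fidelity kernel: by independence `E[κ²] = Tr (M * M)`. The cross terms cancel, so this is `Tr (H *
H) + Tr (𝒜 * 𝒜) ≤ β + ε²` (`re_trace_twirl_mul_self_le`), which is stronger than the claimed bound.

Projected kernel: `0 < κ ≤ 1` and `1 - exp (-t) ≤ t` give `(1 - κ)² ≤ γ ∑ₖ ‖ρₖ - ρₖ'‖₂²`. Comparing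
each reduced state with the maximally mixed one leaves the mean reduced purities, which are `Tr (X *
M)` with `X` exchanging the `k`-th qubits of the two copies. The Haar part is at most `1/2 + β̃`,
and since `X` is unitary, trace-norm duality costs at most `ε` (`re_trace_exchangeOp_mul_twirl_le`).
-/

namespace QuantumKernel

/-! ### Trace-norm inequalities and purity. -/

section LinearAlgebra

variable {ι : Type*} [DecidableEq ι]

/-- The derivative `X ⊗ 1 + 1 ⊗ X` of the representation `V ⊗ V`. -/
def kroneckerSum (X : Matrix ι ι ℂ) : Matrix (ι × ι) (ι × ι) ℂ := X ⊗ₖ 1 + 1 ⊗ₖ X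

theorem kroneckerSum_add (X Y : Matrix ι ι ℂ) :
    kroneckerSum (X + Y) = kroneckerSum X + kroneckerSum Y := by
  simp only [kroneckerSum, Matrix.add_kronecker, Matrix.kronecker_add]; abel

theorem kroneckerSum_smul (c : ℂ) (X : Matrix ι ι ℂ) :
    kroneckerSum (c • X) = c • kroneckerSum X := by
  simp only [kroneckerSum, Matrix.smul_kronecker, Matrix.kronecker_smul, smul_add]

variable [Fintype ι]

theorem re_trace_conjTranspose_mul_self_le (A : Matrix ι ι ℂ) :
    (Aᴴ * A).trace.re ≤ traceNorm A ^ 2 := by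
  have h := (Matrix.isHermitian_conjTranspose_mul_self A).trace_eq_sum_eigenvalues
  rw [h, Complex.re_sum, traceNorm]
  calc ∑ i, (((Matrix.isHermitian_conjTranspose_mul_self A).eigenvalues i : ℂ)).re
      = ∑ i, √((Matrix.isHermitian_conjTranspose_mul_self A).eigenvalues i) ^ 2 := by
        refine Finset.sum_congr rfl fun i _ => ?_
        rw [Real.sq_sqrt (Matrix.eigenvalues_conjTranspose_mul_self_nonneg A i), Complex.ofReal_re]
    _ ≤ _ := Finset.sum_sq_le_sq_sum_of_nonneg fun i _ => Real.sqrt_nonneg _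

/-- In an eigenbasis `W` of `Aᴴ * A` the columns of `A * W` have the singular values as lengths,
while the rows of `Wᴴ * B` are unit vectors. Cauchy–Schwarz on each diagonal entry of the product
finishes. -/
theorem norm_trace_mul_le_traceNorm (A : Matrix ι ι ℂ) {B : Matrix ι ι ℂ}
    (hB : B ∈ Matrix.unitaryGroup ι ℂ) : ‖(B * A).trace‖ ≤ traceNorm A := by
  set hA := Matrix.isHermitian_conjTranspose_mul_self A
  set W := hA.eigenvectorUnitary
  set Q : Matrix ι ι ℂ := (W : Matrix ι ι ℂ)ᴴ * B
  set C : Matrix ι ι ℂ := A * W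
  have hW : (W : Matrix ι ι ℂ) * (W : Matrix ι ι ℂ)ᴴ = 1 := Matrix.mem_unitaryGroup_iff.mp W.2
  have hW' : (W : Matrix ι ι ℂ)ᴴ * (W : Matrix ι ι ℂ) = 1 := Matrix.mem_unitaryGroup_iff'.mp W.2
  have hBB : B * Bᴴ = 1 := Matrix.mem_unitaryGroup_iff.mp hB
  have hQ : Q * Qᴴ = 1 := by
    simp only [Q, Matrix.conjTranspose_mul, Matrix.conjTranspose_conjTranspose]
    rw [Matrix.mul_assoc, ← Matrix.mul_assoc B, hBB, Matrix.one_mul, hW']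
  have hC : Cᴴ * C = Matrix.diagonal (RCLike.ofReal ∘ hA.eigenvalues) := by
    have h := hA.spectral_theorem
    rw [Unitary.conjStarAlgAut_apply] at h
    change Aᴴ * A = (W : Matrix ι ι ℂ) * _ * (W : Matrix ι ι ℂ)ᴴ at h
    have h' := congrArg (fun X => (W : Matrix ι ι ℂ)ᴴ * X * W) h
    simp only [Matrix.mul_assoc] at h'
    rw [hW', Matrix.mul_one, ← Matrix.mul_assoc _ (W : Matrix ι ι ℂ), hW', Matrix.one_mul] at h'
    rw [← h']
    simp only [C, Matrix.conjTranspose_mul, Matrix.mul_assoc]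
  have htr : (B * A).trace = ∑ i, (Q * C) i i := by
    have : Q * C = (W : Matrix ι ι ℂ)ᴴ * (B * A * W) := by simp only [Q, C, Matrix.mul_assoc]
    change _ = (Q * C).trace
    rw [this, Matrix.trace_mul_comm _ (B * A * (W : Matrix ι ι ℂ)), Matrix.mul_assoc, hW, Matrix.mul_one]
  rw [htr, traceNorm]
  refine (norm_sum_le _ _).trans (Finset.sum_le_sum fun i _ => ?_)
  have hq : ∑ j, ‖Q i j‖ ^ 2 = 1 := by
    have h := congrFun (congrFun hQ i) i
    simp only [Matrix.mul_apply, Matrix.conjTranspose_apply, Matrix.one_apply_eq, RCLike.star_def,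
      Complex.mul_conj'] at h
    exact_mod_cast h
  have hc : ∑ j, ‖C j i‖ ^ 2 = hA.eigenvalues i := by
    have h := congrFun (congrFun hC i) i
    simp only [Matrix.mul_apply, Matrix.conjTranspose_apply, Matrix.diagonal_apply_eq,
      RCLike.star_def, Complex.conj_mul', Function.comp_apply] at h
    exact Complex.ofReal_injective (by push_cast; exact h)
  calc ‖(Q * C) i i‖ ≤ ∑ j, ‖Q i j‖ * ‖C j i‖ := by
        rw [Matrix.mul_apply]
        exact (norm_sum_le _ _).trans_eq (Finset.sum_congr rfl fun j _ => norm_mul _ _)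
    _ ≤ √(∑ j, ‖Q i j‖ ^ 2) * √(∑ j, ‖C j i‖ ^ 2) := Real.sum_mul_le_sqrt_mul_sqrt _ _ _
    _ = _ := by rw [hq, hc, Real.sqrt_one, one_mul]

theorem re_trace_mul_self_le_one {ρ : Matrix ι ι ℂ} (hρ : ρ.PosSemidef) (htr : ρ.trace = 1) :
    (ρ * ρ).trace.re ≤ 1 := by
  set hA := hρ.isHermitian
  have hsum : ∑ i, hA.eigenvalues i = 1 := by
    have := hA.trace_eq_sum_eigenvalues
    rw [htr] at this
    exact Complex.ofReal_injective (by push_cast; exact this.symm)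
  have h : (ρ * ρ).trace = ∑ i, (hA.eigenvalues i : ℂ) ^ 2 := by
    conv_lhs => rw [hA.spectral_theorem, ← map_mul, Unitary.conjStarAlgAut_apply,
      Matrix.trace_mul_comm, ← mul_assoc, Unitary.coe_star_mul_self, one_mul,
      Matrix.diagonal_mul_diagonal, Matrix.trace_diagonal]
    simp [sq]
  have h' : (ρ * ρ).trace.re = ∑ i, hA.eigenvalues i ^ 2 := by
    rw [h]
    exact_mod_cast Complex.ofReal_re _
  rw [h']
  exact (Finset.sum_sq_le_sq_sum_of_nonneg fun i _ => hρ.eigenvalues_nonneg i).trans_eq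
    (by rw [hsum, one_pow])

/-! ### The commutant of the operators `W ⊗ W`. -/

/-- The swap of the two tensor factors. -/
def swapOp (ι : Type*) [DecidableEq ι] : Matrix (ι × ι) (ι × ι) ℂ :=
  Matrix.of fun p q => if p.1 = q.2 ∧ p.2 = q.1 then 1 else 0

theorem one_add_smul_mem_unitaryGroup {P : Matrix ι ι ℂ} (hP : P.IsHermitian) (hPP : P * P = P)
    {z : ℂ} (hz : z + star z + z * star z = 0) :
    1 + z • P ∈ Matrix.unitaryGroup ι ℂ := by
  rw [Matrix.mem_unitaryGroup_iff, Matrix.star_eq_conjTranspose, Matrix.conjTranspose_add,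
    Matrix.conjTranspose_one, Matrix.conjTranspose_smul, hP.eq]
  simp only [mul_add, add_mul, mul_one, one_mul, Matrix.smul_mul, Matrix.mul_smul, hPP, smul_smul,
    add_assoc, add_eq_left, ← add_smul]
  rw [show z + (star z + star z * z) = 0 by linear_combination hz, zero_smul]

variable {M : Matrix (ι × ι) (ι × ι) ℂ}

/-- An algebraic replacement for differentiating a one-parameter group: the unitaries `1 + z • P`
with `z = ±I - 1` have opposite values of `z²`, so in the average of their tensor squares the `P ⊗
P` terms cancel and `1 - kroneckerSum P` remains. -/
theorem commute_kroneckerSum_of_projection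
    (hM : ∀ W ∈ Matrix.unitaryGroup ι ℂ, Commute (W ⊗ₖ W) M)
    {P : Matrix ι ι ℂ} (hP : P.IsHermitian) (hPP : P * P = P) : Commute (kroneckerSum P) M := by
  have h₁ := hM _ (one_add_smul_mem_unitaryGroup hP hPP (z := Complex.I - 1)
    (by apply Complex.ext <;> simp))
  have h₂ := hM _ (one_add_smul_mem_unitaryGroup hP hPP (z := -Complex.I - 1)
    (by apply Complex.ext <;> simp))
  have h₃ : kroneckerSum P = 1 - (2⁻¹ : ℂ) •
      ((1 + (Complex.I - 1) • P) ⊗ₖ (1 + (Complex.I - 1) • P) +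
        (1 + (-Complex.I - 1) • P) ⊗ₖ (1 + (-Complex.I - 1) • P)) := by
    have hI := Complex.I_mul_I
    ext p q
    simp only [kroneckerSum, Matrix.add_apply, Matrix.sub_apply, Matrix.smul_apply, smul_eq_mul,
      Matrix.kroneckerMap_apply, ← Matrix.one_kronecker_one (α := ℂ) (m := ι) (n := ι)]
    linear_combination (P p.1 q.1 * P p.2 q.2) * hI
  rw [h₃]
  exact (Commute.one_left M).sub_left ((h₁.add_left h₂).smul_left _)

theorem commute_kroneckerSum_single
    (hM : ∀ W ∈ Matrix.unitaryGroup ι ℂ, Commute (W ⊗ₖ W) M) (i j : ι) :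
    Commute (kroneckerSum (Matrix.single i j 1)) M := by
  have hdiag : ∀ i : ι, Commute (kroneckerSum (Matrix.single i i 1)) M := fun i =>
    commute_kroneckerSum_of_projection hM (by simp [Matrix.IsHermitian]) (by simp)
  by_cases hij : i = j
  · exact hij ▸ hdiag i
  have hoff : ∀ z : ℂ, star z * z = 1 →
      Commute (kroneckerSum (Matrix.single i j z + Matrix.single j i (star z))) M := by
    intro z hz
    have hz' : z * star z = 1 := by rw [mul_comm, hz]
    -- For `|z| = 1` this is the rank-one projection onto the line spanned by `z • eᵢ + eⱼ`.
    have hH := commute_kroneckerSum_of_projection hM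
      (P := (2⁻¹ : ℂ) • (Matrix.single i i 1 + Matrix.single j j 1 +
        (Matrix.single i j z + Matrix.single j i (star z))))
      (by
        simp only [Matrix.IsHermitian, Matrix.conjTranspose_smul, Matrix.conjTranspose_add,
          Matrix.conjTranspose_single, star_star, star_one]
        rw [add_comm (Matrix.single j i (star z))]
        simp)
      (by
        simp only [Matrix.smul_mul, Matrix.mul_smul, mul_add, add_mul,
          Matrix.single_mul_single_same, mul_one, one_mul, hz, hz', ne_eq, hij, Ne.symm hij,
          not_false_eq_true, Matrix.single_mul_single_of_ne, add_zero, zero_add]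
        module)
    rw [kroneckerSum_smul, kroneckerSum_add, kroneckerSum_add (Matrix.single i i 1)] at hH
    have h := ((hH.smul_left (2 : ℂ)).sub_left (hdiag i)).sub_left (hdiag j)
    rwa [show (2 : ℂ) • (2⁻¹ : ℂ) • (kroneckerSum (Matrix.single i i 1) +
        kroneckerSum (Matrix.single j j 1) +
        kroneckerSum (Matrix.single i j z + Matrix.single j i (star z))) -
        kroneckerSum (Matrix.single i i 1) - kroneckerSum (Matrix.single j j 1) =
        kroneckerSum (Matrix.single i j z + Matrix.single j i (star z)) by module] at h
  have h1 := hoff 1 (by simp)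
  have hI := hoff Complex.I (by simp)
  -- Polarisation: the cases `z = 1` and `z = I` combine so that the `(j, i)` unit cancels.
  have h := (h1.smul_left (2⁻¹ : ℂ)).add_left (hI.smul_left (-(2⁻¹ : ℂ) * Complex.I))
  rw [← kroneckerSum_smul, ← kroneckerSum_smul, ← kroneckerSum_add] at h
  refine (congrArg (fun X => Commute (kroneckerSum X) M) ?_).mpr h
  have hII : (-(2⁻¹ : ℂ) * Complex.I) * Complex.I = 2⁻¹ := by
    rw [mul_assoc, Complex.I_mul_I]; ring
  have hII' : (-(2⁻¹ : ℂ) * Complex.I) * (star Complex.I) = -2⁻¹ := by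
    rw [RCLike.star_def, Complex.conj_I, mul_neg, hII]
  simp only [smul_add, Matrix.smul_single, smul_eq_mul, hII, hII', star_one, mul_one]
  rw [show Matrix.single j i (-(2⁻¹ : ℂ)) = - Matrix.single j i 2⁻¹ by
    simp [← Matrix.single_neg], show (1 : ℂ) = 2⁻¹ + 2⁻¹ by norm_num, Matrix.single_add]
  abel

/-- The commutant of the operators `W ⊗ W` is spanned by the identity and the swap. -/
theorem exists_eq_smul_one_add_smul_swapOp
    (hM : ∀ W ∈ Matrix.unitaryGroup ι ℂ, Commute (W ⊗ₖ W) M)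
    (hswap : ∀ i j k l, M (i, j) (k, l) = M (j, i) (l, k)) :
    ∃ a b : ℂ, M = a • 1 + b • swapOp ι := by
  have key : ∀ i j p q r s : ι, (if p = i then M (j, q) (r, s) else 0) +
      (if q = i then M (p, j) (r, s) else 0) = (if r = j then M (p, q) (i, s) else 0) +
      (if s = j then M (p, q) (r, i) else 0) := by
    intro i j p q r s
    have h := congrFun (congrFun (commute_kroneckerSum_single hM i j).eq (p, q)) (r, s)
    simp only [kroneckerSum, add_mul, mul_add, Matrix.add_apply, Matrix.mul_apply,
      Fintype.sum_prod_type, Matrix.kroneckerMap_apply, Finset.sum_add_distrib, Matrix.single_apply, Matrix.one_apply] at h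
    simp only [ite_and, mul_ite, ite_mul, mul_one, mul_zero, zero_mul, one_mul,
      Finset.sum_ite_irrel, Finset.sum_const_zero, Finset.sum_ite_eq, Finset.sum_ite_eq',
      Finset.mem_univ, if_true, eq_comm (a := i), eq_comm (a := j)] at h
    exact h
  -- Weight argument: diagonal units count how often an index occurs, so a nonzero entry needs `{p,
  -- q} = {r, s}` as multisets.
  have hzero : ∀ p q r s : ι, ¬(p = r ∧ q = s) → ¬(p = s ∧ q = r) → M (p, q) (r, s) = 0 := by
    intro p q r s h₁ h₂
    have k₁ := key p p p q r s
    have k₂ := key q q p q r s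
    by_cases hpr : p = r
    · have hsq : s ≠ q := fun h => h₁ ⟨hpr, h.symm⟩
      subst hpr
      by_cases hpq : p = q
      · simpa [hsq, hpq] using k₂
      · simpa [hsq, hpq] using k₂
    by_cases hsp : s = p
    · have hrq : r ≠ q := fun h => h₂ ⟨hsp.symm, h.symm⟩
      subst hsp
      by_cases hqs : q = s
      · simpa [hqs, Ne.symm hpr] using k₁
      · simpa [hrq, Ne.symm hqs] using k₂
    · by_cases hqp : q = p
      · simpa [hqp, Ne.symm hpr, hsp] using k₁
      · simpa [hqp, Ne.symm hpr, hsp] using k₁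
  rcases subsingleton_or_nontrivial ι with hι | ⟨i₀, j₀, hij₀⟩
  · rcases isEmpty_or_nonempty ι with he | ⟨⟨x⟩⟩
    · exact ⟨0, 0, by ext ⟨i, j⟩; exact he.elim i⟩
    · refine ⟨M (x, x) (x, x), 0, ?_⟩
      ext ⟨i, j⟩ ⟨k, l⟩
      obtain rfl := Subsingleton.elim i x
      obtain rfl := Subsingleton.elim j i
      obtain rfl := Subsingleton.elim k j
      obtain rfl := Subsingleton.elim l k
      simp
  -- Off-diagonal units relate the surviving entries to each other; `hswap` supplies the passage
  -- from `(i, j)` to `(j, i)`.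
  have hstep : ∀ i j q : ι, i ≠ q → j ≠ q → M (i, q) (i, q) = M (j, q) (j, q) := by
    intro i j q hi hj
    have := key i j i q j q
    grind
  have hconst : ∀ i j, i ≠ j → M (i, j) (i, j) = M (i₀, j₀) (i₀, j₀) := by
    intro i j hij
    by_cases hj : j = i₀
    · rw [hj, hstep i j₀ i₀ (hj ▸ hij) hij₀.symm, hswap]
    · rw [hstep i i₀ j hij (Ne.symm hj), hswap, hstep j j₀ i₀ hj hij₀.symm, hswap]
  have hdiag : ∀ i j, i ≠ j → M (j, j) (j, j) = M (i, j) (i, j) + M (i, j) (j, i) := by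
    intro i j hij
    have := key i j i j j j
    grind
  have hdiagc : ∀ i j, M (i, i) (i, i) = M (j, j) (j, j) := by
    intro i j
    by_cases hij : i = j
    · rw [hij]
    rw [hdiag i j hij, hdiag j i (Ne.symm hij), hswap j i j i, hswap j i i j]
  -- In `a • 1 + b • swap` the diagonal entry at `(p, q)` is `a` for `p ≠ q` and `a + b` for `p =
  -- q`.
  refine ⟨M (i₀, j₀) (i₀, j₀), M (i₀, i₀) (i₀, i₀) - M (i₀, j₀) (i₀, j₀), ?_⟩
  ext ⟨p, q⟩ ⟨r, s⟩
  simp only [Matrix.add_apply, Matrix.smul_apply, swapOp, Matrix.of_apply, Matrix.one_apply,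
    smul_eq_mul, Prod.mk.injEq]
  by_cases h₁ : p = r ∧ q = s
  · obtain ⟨rfl, rfl⟩ := h₁
    by_cases hpq : p = q
    · subst hpq
      simp [hdiagc p i₀]
    · simp [hpq, hconst p q hpq]
  by_cases h₂ : p = s ∧ q = r
  · obtain ⟨rfl, rfl⟩ := h₂
    have hpq : p ≠ q := fun h => h₁ ⟨h, h.symm⟩
    simp [hpq, ← hdiagc q i₀, hdiag p q hpq, hconst p q hpq]
  · simp [h₁, h₂, hzero p q r s h₁ h₂]

end LinearAlgebra

/-! ### Traces against the swap, and purity as a sum of squares. -/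

section Trace

variable {ι : Type*} [Fintype ι]

theorem trace_swapOp_mul [DecidableEq ι] (X : Matrix (ι × ι) (ι × ι) ℂ) :
    (swapOp ι * X).trace = ∑ i, ∑ j, X (j, i) (i, j) := by
  simp only [Matrix.trace, Matrix.diag_apply, Matrix.mul_apply, swapOp, Matrix.of_apply,
    Fintype.sum_prod_type, ite_and, ite_mul, one_mul, zero_mul]
  refine Finset.sum_congr rfl fun i _ => Finset.sum_congr rfl fun j _ => ?_
  rw [Finset.sum_eq_single j (fun b _ hb => by simp [Ne.symm hb]) (by simp)]
  simp

theorem trace_mul_self_eq_ofReal {ρ : Matrix ι ι ℂ} (hρ : ρ.IsHermitian) :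
    (ρ * ρ).trace = ((∑ i, ∑ j, ‖ρ i j‖ ^ 2 : ℝ) : ℂ) := by
  simp only [Matrix.trace, Matrix.diag_apply, Matrix.mul_apply]
  push_cast
  refine Finset.sum_congr rfl fun i _ => Finset.sum_congr rfl fun j _ => ?_
  rw [← hρ.apply j i, RCLike.star_def, Complex.mul_conj']

end Trace

/-! ### Twirls and the explicit Haar twirl. -/

section Twirl

variable {n : ℕ}

/-- The conjugate `V ρ V†` of an operator by a unitary. -/
def rotate (ρ : Op n) (V : UGroup n) : Op n := (V : Op n) * ρ * (V : Op n)ᴴ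

theorem rotate_kronecker (ρ : Op n) (V : UGroup n) :
    ((V : Op n) ⊗ₖ (V : Op n)) * (ρ ⊗ₖ ρ) * ((V : Op n)ᴴ ⊗ₖ (V : Op n)ᴴ) =
      rotate ρ V ⊗ₖ rotate ρ V := by
  rw [← Matrix.mul_kronecker_mul, ← Matrix.mul_kronecker_mul, rotate]

theorem twirl_apply (ν : Measure (UGroup n)) (ρ : Op n) (p q : Bits n × Bits n) :
    twirl ν ρ p q = ∫ V, rotate ρ V p.1 q.1 * rotate ρ V p.2 q.2 ∂ν := by
  simp only [twirl, Matrix.of_apply, rotate_kronecker, Matrix.kroneckerMap_apply]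

theorem continuous_rotate (ρ : Op n) : Continuous (rotate ρ) := by
  unfold rotate
  fun_prop

theorem continuous_rotate_apply (ρ : Op n) (i k : Bits n) :
    Continuous fun V => rotate ρ V i k :=
  (continuous_rotate ρ).matrix_elem i k

theorem continuous_rotate_mul (ρ : Op n) (i j k l : Bits n) :
    Continuous fun V => rotate ρ V i k * rotate ρ V j l :=
  (continuous_rotate_apply ρ i k).mul (continuous_rotate_apply ρ j l)

theorem integrable_rotate_mul (ν : Measure (UGroup n)) [IsFiniteMeasure ν] (ρ : Op n)
    (i j k l : Bits n) : Integrable (fun V => rotate ρ V i k * rotate ρ V j l) ν :=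
  (continuous_rotate_mul ρ i j k l).integrable_of_hasCompactSupport
    (HasCompactSupport.of_compactSpace _)

theorem conjTranspose_mul_coe (V : UGroup n) : (V : Op n)ᴴ * (V : Op n) = 1 :=
  Matrix.mem_unitaryGroup_iff'.mp V.2

theorem rotate_mul_rotate (ρ : Op n) (V : UGroup n) :
    rotate ρ V * rotate ρ V = rotate (ρ * ρ) V := by
  simp only [rotate, Matrix.mul_assoc]
  rw [← Matrix.mul_assoc _ (V : Op n), conjTranspose_mul_coe, Matrix.one_mul]

theorem trace_rotate (ρ : Op n) (V : UGroup n) : (rotate ρ V).trace = ρ.trace := by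
  rw [rotate, Matrix.trace_mul_comm, ← Matrix.mul_assoc, conjTranspose_mul_coe, Matrix.one_mul]

theorem isState_rotate {ρ : Op n} (hρ : IsState ρ) (V : UGroup n) : IsState (rotate ρ V) :=
  ⟨hρ.1.mul_mul_conjTranspose_same _, by rw [trace_rotate, hρ.2]⟩

theorem rotate_mul (ρ : Op n) (W V : UGroup n) :
    rotate ρ (W * V) = (W : Op n) * rotate ρ V * (W : Op n)ᴴ := by
  simp only [rotate, Submonoid.coe_mul, Matrix.conjTranspose_mul, Matrix.mul_assoc]

theorem trace_twirl (ν : Measure (UGroup n)) [IsProbabilityMeasure ν] {ρ : Op n}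
    (hρ : IsState ρ) : (twirl ν ρ).trace = 1 := by
  simp only [Matrix.trace, Matrix.diag_apply, twirl_apply]
  rw [← integral_finsetSum _ fun p _ => integrable_rotate_mul ν ρ _ _ _ _]
  have h : ∀ V, ∑ p : Bits n × Bits n, rotate ρ V p.1 p.1 * rotate ρ V p.2 p.2 = 1 := by
    intro V
    have h1 : ∑ i, rotate ρ V i i = 1 := (isState_rotate hρ V).2
    rw [Fintype.sum_prod_type]
    simp only [← Finset.mul_sum, h1, mul_one]
  simp [h]

/-- Swap trick: the integrand is the purity of `V ρ V†`, which does not depend on `V`. -/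
theorem trace_swapOp_mul_twirl (ν : Measure (UGroup n)) [IsProbabilityMeasure ν] (ρ : Op n) :
    (swapOp (Bits n) * twirl ν ρ).trace = (ρ * ρ).trace := by
  simp only [trace_swapOp_mul, twirl_apply]
  rw [← Fintype.sum_prod_type' (f := fun i j => ∫ V, rotate ρ V j i * rotate ρ V i j ∂ν),
    ← integral_finsetSum _ fun p _ => integrable_rotate_mul ν ρ _ _ _ _]
  have h : ∀ V, ∑ p : Bits n × Bits n, rotate ρ V p.2 p.1 * rotate ρ V p.1 p.2 =
      (ρ * ρ).trace := by
    intro V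
    rw [← trace_rotate _ V, ← rotate_mul_rotate, Matrix.trace, Fintype.sum_prod_type]
    simp only [Matrix.diag_apply, Matrix.mul_apply, mul_comm]
  simp [h]

theorem isHermitian_twirl (ν : Measure (UGroup n)) {ρ : Op n} (hρ : ρ.IsHermitian) :
    (twirl ν ρ).IsHermitian := by
  ext p q
  have h : ∀ V, (rotate ρ V).IsHermitian := fun V =>
    Matrix.isHermitian_mul_mul_conjTranspose _ hρ
  rw [Matrix.conjTranspose_apply, twirl_apply, twirl_apply, RCLike.star_def, ← integral_conj]
  refine integral_congr_ae (.of_forall fun V => ?_)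
  simp only [map_mul]
  rw [← (h V).apply p.1 q.1, ← (h V).apply p.2 q.2]
  rfl

instance isProbabilityMeasure_haar : IsProbabilityMeasure (haar n) :=
  ⟨Measure.haarMeasure_self (K₀ := (⊤ : TopologicalSpace.PositiveCompacts (UGroup n)))⟩

instance isMulLeftInvariant_haar : (haar n).IsMulLeftInvariant := by
  unfold haar; infer_instance

/-- Left invariance absorbs `W` into the integration variable; the rest moves finite sums through
the integral. -/
theorem kronecker_mul_twirl_haar (ρ : Op n) (W : UGroup n) :
    ((W : Op n) ⊗ₖ (W : Op n)) * twirl (haar n) ρ * ((W : Op n) ⊗ₖ (W : Op n))ᴴ =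
      twirl (haar n) ρ := by
  ext p q
  have h : ∀ V, ∑ r, (∑ s, ((W : Op n) ⊗ₖ (W : Op n)) p s * (rotate ρ V s.1 r.1 *
      rotate ρ V s.2 r.2)) * ((W : Op n) ⊗ₖ (W : Op n))ᴴ r q =
      rotate ρ (W * V) p.1 q.1 * rotate ρ (W * V) p.2 q.2 := by
    intro V
    change (((W : Op n) ⊗ₖ (W : Op n)) * (rotate ρ V ⊗ₖ rotate ρ V) *
      ((W : Op n) ⊗ₖ (W : Op n))ᴴ) p q = (rotate ρ (W * V) ⊗ₖ rotate ρ (W * V)) p q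
    rw [Matrix.conjTranspose_kronecker, ← Matrix.mul_kronecker_mul, ← Matrix.mul_kronecker_mul,
      rotate_mul]
  rw [twirl_apply, ← integral_mul_left_eq_self _ W]
  simp only [← h]
  have hi : ∀ r s : Bits n × Bits n, Integrable (fun V => ((W : Op n) ⊗ₖ (W : Op n)) p s * (rotate ρ V s.1 r.1 *
      rotate ρ V s.2 r.2)) (haar n) := fun r s =>
    (integrable_rotate_mul _ ρ _ _ _ _).const_mul _
  rw [integral_finsetSum _ fun r _ => (integrable_finsetSum _ fun s _ => hi r s).mul_const _]
  simp only [integral_mul_const, integral_finsetSum _ fun s _ => hi _ s, integral_const_mul,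
    Matrix.mul_apply, twirl_apply]

theorem commute_kronecker_twirl_haar (ρ : Op n) (W : Op n)
    (hW : W ∈ Matrix.unitaryGroup (Bits n) ℂ) : Commute (W ⊗ₖ W) (twirl (haar n) ρ) := by
  have h := congrArg (· * (W ⊗ₖ W)) (kronecker_mul_twirl_haar ρ ⟨W, hW⟩)
  simp only [Matrix.mul_assoc] at h
  rwa [Matrix.conjTranspose_kronecker, ← Matrix.mul_kronecker_mul,
    show Wᴴ * W = 1 from Matrix.mem_unitaryGroup_iff'.mp hW, Matrix.one_kronecker_one,
    Matrix.mul_one] at h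

theorem card_bits : (Fintype.card (Bits n) : ℂ) = 2 ^ n := by simp

theorem twirl_haar_eq (hn : 1 ≤ n) {ρ : Op n} (hρ : IsState ρ) :
    twirl (haar n) ρ =
      (((2 ^ n - (ρ * ρ).trace.re) / (2 ^ n * ((2 ^ n) ^ 2 - 1)) : ℝ) : ℂ) • 1 +
      (((2 ^ n * (ρ * ρ).trace.re - 1) / (2 ^ n * ((2 ^ n) ^ 2 - 1)) : ℝ) : ℂ) •
        swapOp (Bits n) := by
  obtain ⟨a, b, hab⟩ := exists_eq_smul_one_add_smul_swapOp (commute_kronecker_twirl_haar ρ)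
    (fun i j k l => by simp only [twirl_apply, mul_comm])
  have h1 := trace_twirl (haar n) hρ
  have h2 := trace_swapOp_mul_twirl (haar n) ρ
  have hP : (ρ * ρ).trace = ((ρ * ρ).trace.re : ℂ) := by
    rw [trace_mul_self_eq_ofReal hρ.1.isHermitian, Complex.ofReal_re]
  have hS : (swapOp (Bits n)).trace = 2 ^ n := by
    rw [← mul_one (swapOp (Bits n)), trace_swapOp_mul]
    simp [Matrix.one_apply, ite_and]
  have hSS : (swapOp (Bits n) * swapOp (Bits n)).trace = (2 ^ n) ^ 2 := by
    rw [trace_swapOp_mul]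
    simp [swapOp, sq]
  have h1' : (1 : Op₂ n).trace = (2 ^ n) ^ 2 := by
    rw [Matrix.trace_one, Fintype.card_prod]
    push_cast
    rw [card_bits, sq]
  rw [hab, Matrix.trace_add, Matrix.trace_smul, Matrix.trace_smul, hS, h1', smul_eq_mul,
    smul_eq_mul] at h1
  rw [hab, mul_add, Matrix.mul_smul, Matrix.mul_smul, mul_one, Matrix.trace_add,
    Matrix.trace_smul, Matrix.trace_smul, hS, hSS, smul_eq_mul, smul_eq_mul, hP] at h2
  have hd : (2 : ℂ) ^ n ≠ 0 := by positivity
  have hd2 : ((2 : ℂ) ^ n) ^ 2 - 1 ≠ 0 := by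
    have : (1 : ℝ) < (2 ^ n) ^ 2 := by
      rw [← pow_mul]
      exact one_lt_pow₀ (by norm_num) (by omega)
    have h : (((2 ^ n) ^ 2 - 1 : ℝ) : ℂ) ≠ 0 := Complex.ofReal_ne_zero.mpr (by linarith)
    exact_mod_cast h
  rw [hab]
  congr 2
  -- The equations solved are `a d² + b d = 1` and `a d + b d² = P`.
  · push_cast
    rw [eq_div_iff (mul_ne_zero hd hd2)]
    linear_combination (2 ^ n : ℂ) * h1 - h2
  · push_cast
    rw [eq_div_iff (mul_ne_zero hd hd2)]
    linear_combination (2 ^ n : ℂ) * h2 - h1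

end Twirl

/-! ### Second-moment bound for the fidelity kernel. -/

section Deviation

variable {n : ℕ}

/-- The point is that the right-hand side is free of `ν`: every twirl has the same overlap with the
Haar twirl. -/
theorem trace_twirl_haar_mul (hn : 1 ≤ n) {ρ : Op n} (hρ : IsState ρ)
    (ν : Measure (UGroup n)) [IsProbabilityMeasure ν] :
    (twirl (haar n) ρ * twirl ν ρ).trace =
      (((2 ^ n - (ρ * ρ).trace.re) / (2 ^ n * ((2 ^ n) ^ 2 - 1)) +
      (2 ^ n * (ρ * ρ).trace.re - 1) / (2 ^ n * ((2 ^ n) ^ 2 - 1)) * (ρ * ρ).trace.re : ℝ) :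
        ℂ) := by
  have hP : (ρ * ρ).trace = ((ρ * ρ).trace.re : ℂ) := by
    rw [trace_mul_self_eq_ofReal hρ.1.isHermitian, Complex.ofReal_re]
  rw [twirl_haar_eq hn hρ, add_mul, Matrix.smul_mul, Matrix.smul_mul, one_mul, Matrix.trace_add,
    Matrix.trace_smul, Matrix.trace_smul, trace_twirl ν hρ, trace_swapOp_mul_twirl, smul_eq_mul,
    smul_eq_mul, mul_one, Complex.ofReal_add, Complex.ofReal_mul, ← hP]

theorem two_le_two_pow (hn : 1 ≤ n) : (2 : ℝ) ≤ 2 ^ n := by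
  simpa using pow_le_pow_right₀ (one_le_two : (1 : ℝ) ≤ 2) hn

theorem purity_mem_Icc {ρ : Op n} (hρ : IsState ρ) : (ρ * ρ).trace.re ∈ Set.Icc (0 : ℝ) 1 := by
  refine ⟨?_, re_trace_mul_self_le_one hρ.1 hρ.2⟩
  rw [trace_mul_self_eq_ofReal hρ.1.isHermitian, Complex.ofReal_re]
  positivity

theorem betaHaar_eq (hn : 1 ≤ n) : betaHaar n = 2 / (2 ^ n * (2 ^ n + 1)) := by
  obtain ⟨m, rfl⟩ := Nat.exists_eq_add_of_le' hn
  rw [betaHaar, Nat.add_sub_cancel]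
  have : (0 : ℝ) < 2 ^ m := by positivity
  field_simp
  ring

theorem re_trace_twirl_mul_self_le (hn : 1 ≤ n) {ρ : Op n} (hρ : IsState ρ)
    (ν : Measure (UGroup n)) [IsProbabilityMeasure ν] :
    (twirl ν ρ * twirl ν ρ).trace.re ≤ betaHaar n + expressivity ν ρ ^ 2 := by
  set H := twirl (haar n) ρ
  set M := twirl ν ρ
  have hHH := trace_twirl_haar_mul hn hρ (haar n)
  have hHM := trace_twirl_haar_mul hn hρ ν
  have hA : (deviation ν ρ).IsHermitian :=
    (isHermitian_twirl _ hρ.1.isHermitian).sub (isHermitian_twirl _ hρ.1.isHermitian)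
  have hle := re_trace_conjTranspose_mul_self_le (deviation ν ρ)
  rw [hA.eq] at hle
  have hexp : (M * M).trace = (H * M).trace + (deviation ν ρ * deviation ν ρ).trace := by
    simp only [deviation, sub_mul, mul_sub, Matrix.trace_sub]
    change _ = _ + ((H * H).trace - (M * H).trace - ((H * M).trace - (M * M).trace))
    rw [Matrix.trace_mul_comm M H, hHH.trans hHM.symm]
    ring
  rw [hexp, Complex.add_re, hHM, Complex.ofReal_re]
  refine add_le_add ?_ hle
  obtain ⟨h0, h1⟩ := purity_mem_Icc hρ
  have hd := two_le_two_pow hn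
  rw [betaHaar_eq hn]
  generalize (ρ * ρ).trace.re = P at *
  generalize (2 : ℝ) ^ n = d at *
  have hd0 : 0 < d := by linarith
  have hd1 : 0 < d ^ 2 - 1 := by nlinarith
  rw [div_mul_eq_mul_div, ← add_div, div_le_div_iff₀ (by positivity) (by positivity)]
  -- The difference factors as `(1 - P) (d P + d - 2)`; equality holds for pure states.
  have key : d - P + (d * P - 1) * P ≤ 2 * (d - 1) := by
    nlinarith [mul_nonneg (sub_nonneg.mpr h1) (by nlinarith : 0 ≤ d * P + d - 2)]
  calc _ ≤ 2 * (d - 1) * (d * (d + 1)) := by gcongr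
    _ = _ := by ring

/-! ### Single-qubit exchange and the mean reduced purity. -/

/-- Exchange of the `k`-th qubits of the two copies. -/
def exchange (k : Fin n) (p : Bits n × Bits n) : Bits n × Bits n :=
  (Function.update p.1 k (p.2 k), Function.update p.2 k (p.1 k))

theorem exchange_involutive (k : Fin n) : Function.Involutive (exchange k) := by
  intro p
  simp [exchange]

/-- The operator that exchanges the `k`-th qubits of the two copies. -/
def exchangeOp (k : Fin n) : Op₂ n :=
  Matrix.of fun p q => if q = exchange k p then 1 else 0

theorem exchangeOp_mul_apply (k : Fin n) (X : Op₂ n) (p q : Bits n × Bits n) :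
    (exchangeOp k * X) p q = X (exchange k p) q := by
  simp [exchangeOp, Matrix.mul_apply]

theorem exchangeOp_mem_unitaryGroup (k : Fin n) :
    exchangeOp k ∈ Matrix.unitaryGroup (Bits n × Bits n) ℂ := by
  rw [Matrix.mem_unitaryGroup_iff, Matrix.star_eq_conjTranspose]
  ext p q
  rw [exchangeOp_mul_apply]
  simp [exchangeOp, Matrix.one_apply, (exchange_involutive k).injective.eq_iff, eq_comm,
    apply_ite]

theorem trace_exchangeOp_mul (k : Fin n) (X : Op₂ n) :
    (exchangeOp k * X).trace = ∑ p, X (exchange k p) p := by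
  simp only [Matrix.trace, Matrix.diag_apply, exchangeOp_mul_apply]

/-- The swap trick on one qubit: it makes the overlap of reduced states linear in `σ ⊗ τ`, hence
computable from a twirl. -/
theorem sum_reduced_mul (k : Fin n) (σ τ : Op n) :
    ∑ a, ∑ b, reduced k σ a b * reduced k τ b a =
      ∑ p : Bits n × Bits n, σ p.1 (exchange k p).1 * τ p.2 (exchange k p).2 := by
  have h : ∀ a b, reduced k σ a b * reduced k τ b a = ∑ z : Bits n, ∑ w : Bits n,
      if z k = a then if w k = b then
        σ z (Function.update z k (w k)) * τ w (Function.update w k (z k)) else 0 else 0 := by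
    intro a b
    simp only [reduced, Matrix.of_apply, Finset.sum_filter, Finset.sum_mul_sum]
    refine Finset.sum_congr rfl fun z _ => Finset.sum_congr rfl fun w _ => ?_
    split_ifs with h1 h2 <;> simp [*]
  simp only [h, Fintype.sum_prod_type, exchange]
  rw [Finset.sum_congr rfl fun a _ => Finset.sum_comm, Finset.sum_comm]
  refine Finset.sum_congr rfl fun z _ => ?_
  rw [Finset.sum_congr rfl fun a _ => Finset.sum_comm, Finset.sum_comm]
  refine Finset.sum_congr rfl fun w _ => ?_
  simp

theorem card_filter_apply_eq (hn : 1 ≤ n) (k : Fin n) (c : Fin 2) :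
    ((Finset.univ.filter fun w : Bits n => w k = c).card : ℂ) = 2 ^ n / 2 := by
  have h : (Finset.univ.filter fun w : Bits n => w k = c) =
      Fintype.piFinset fun i => if i = k then {c} else Finset.univ := by
    ext w
    simp only [Finset.mem_filter, Finset.mem_univ, true_and, Fintype.mem_piFinset]
    refine ⟨fun hw i => ?_, fun hw => by simpa using hw k⟩
    split_ifs with hi
    · simpa [hi] using hw
    · simp
  obtain ⟨m, rfl⟩ := Nat.exists_eq_add_of_le' hn
  rw [h, Fintype.card_piFinset, ← Finset.mul_prod_erase _ _ (Finset.mem_univ k),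
    Finset.prod_congr rfl fun i hi => by rw [if_neg (Finset.ne_of_mem_erase hi)]]
  simp [pow_succ]

theorem trace_exchangeOp (hn : 1 ≤ n) (k : Fin n) :
    (exchangeOp k).trace = (2 ^ n) ^ 2 / 2 := by
  have h : ∀ z w : Bits n, (z, w) = exchange k (z, w) ↔ w k = z k := by
    intro z w
    simp [exchange, Prod.ext_iff, eq_comm]
  simp only [Matrix.trace, Matrix.diag_apply, exchangeOp, Matrix.of_apply]
  rw [Fintype.sum_prod_type]
  simp only [h, Finset.sum_boole, card_filter_apply_eq hn]
  simp
  ring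

/-- Only pairs of labels that agree off `k` contribute: `2 ^ n` choices of the first and two of the
second. -/
theorem trace_exchangeOp_mul_swapOp (k : Fin n) :
    (exchangeOp k * swapOp (Bits n)).trace = 2 * 2 ^ n := by
  have h : ∀ z : Bits n, (Finset.univ.filter fun w => (exchange k (z, w)).1 = w ∧
      (exchange k (z, w)).2 = z) = Finset.univ.image (Function.update z k) := by
    intro z
    ext w
    rw [Finset.mem_filter, Finset.mem_image]
    constructor
    · rintro ⟨-, hw, -⟩
      exact ⟨w k, Finset.mem_univ _, hw⟩
    · rintro ⟨b, -, rfl⟩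
      simp [exchange]
  rw [trace_exchangeOp_mul, Fintype.sum_prod_type]
  simp only [swapOp, Matrix.of_apply, Finset.sum_boole, h, Finset.card_image_of_injective _ (Function.update_injective _ k)]
  simp
  ring

theorem re_trace_exchangeOp_mul_twirl_le (hn : 1 ≤ n) {ρ : Op n} (hρ : IsState ρ)
    (ν : Measure (UGroup n)) (k : Fin n) :
    (exchangeOp k * twirl ν ρ).trace.re ≤ 1 / 2 + betaTildeHaar n + expressivity ν ρ := by
  have hA := (Complex.abs_re_le_norm _).trans
    (norm_trace_mul_le_traceNorm (deviation ν ρ) (exchangeOp_mem_unitaryGroup k))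
  have hM : twirl ν ρ = twirl (haar n) ρ - deviation ν ρ := by simp [deviation]
  rw [hM, mul_sub, Matrix.trace_sub, Complex.sub_re]
  have hH : (exchangeOp k * twirl (haar n) ρ).trace.re ≤ 1 / 2 + betaTildeHaar n := by
    rw [twirl_haar_eq hn hρ, mul_add, Matrix.mul_smul, Matrix.mul_smul, mul_one,
      Matrix.trace_add, Matrix.trace_smul, Matrix.trace_smul, trace_exchangeOp hn,
      trace_exchangeOp_mul_swapOp, smul_eq_mul, smul_eq_mul,
      show (2 ^ n : ℂ) ^ 2 / 2 = (((2 ^ n) ^ 2 / 2 : ℝ) : ℂ) by push_cast; rfl,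
      show (2 * 2 ^ n : ℂ) = ((2 * 2 ^ n : ℝ) : ℂ) by push_cast; rfl, ← Complex.ofReal_mul,
      ← Complex.ofReal_mul, ← Complex.ofReal_add, Complex.ofReal_re]
    obtain ⟨h0, h1⟩ := purity_mem_Icc hρ
    have hd := two_le_two_pow hn
    rw [betaTildeHaar, pow_succ (2 : ℝ)]
    generalize (ρ * ρ).trace.re = P at *
    generalize (2 : ℝ) ^ n = d at *
    have hd0 : 0 < d := by linarith
    have hd1 : 0 < d ^ 2 - 1 := by nlinarith
    -- The left side increases with `P`, with equality at `P = 1`.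
    have hP : (d * P - 1) / (d ^ 2 - 1) ≤ 1 / (d + 1) := by
      rw [div_le_div_iff₀ hd1 (by linarith)]
      nlinarith
    calc _ = 1 / 2 + 3 / 2 * ((d * P - 1) / (d ^ 2 - 1)) := by
          field_simp
          ring
      _ ≤ 1 / 2 + 3 / 2 * (1 / (d + 1)) := by gcongr
      _ = _ := by
          field_simp
  have := (abs_le.mp hA).1
  rw [expressivity]
  linarith

end Deviation

/-! ### Reduced states and their distance from the maximally mixed qubit. -/

section Reduced

variable {n : ℕ}

theorem isHermitian_reduced {σ : Op n} (hσ : σ.IsHermitian) (k : Fin n) :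
    (reduced k σ).IsHermitian := by
  ext a b
  simp only [Matrix.conjTranspose_apply, reduced, Matrix.of_apply, star_sum, hσ.apply]
  refine Finset.sum_nbij' (fun z => Function.update z k a) (fun z => Function.update z k b)
    ?_ ?_ ?_ ?_ ?_ <;>
  · intro z hz
    simp only [Finset.mem_filter, Finset.mem_univ, true_and] at hz
    simp [← hz]

theorem trace_reduced (σ : Op n) (k : Fin n) : (reduced k σ).trace = σ.trace := by
  simp only [Matrix.trace, Matrix.diag_apply, reduced, Matrix.of_apply]
  rw [← Finset.sum_fiberwise (s := Finset.univ) (g := fun z : Bits n => z k)]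
  refine Finset.sum_congr rfl fun a _ => Finset.sum_congr rfl fun z hz => ?_
  rw [← (Finset.mem_filter.mp hz).2, Function.update_eq_self]

theorem schattenTwoNorm_sq {ι : Type*} [Fintype ι] (D : Matrix ι ι ℂ) :
    schattenTwoNorm D ^ 2 = ∑ i, ∑ j, ‖D i j‖ ^ 2 := by
  have h : (Dᴴ * D).trace.re = ∑ i, ∑ j, ‖D i j‖ ^ 2 := by
    simp only [Matrix.trace, Matrix.diag_apply, Matrix.mul_apply, Matrix.conjTranspose_apply,
      RCLike.star_def, Complex.conj_mul', Complex.re_sum]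
    rw [Finset.sum_comm]
    refine Finset.sum_congr rfl fun i _ => Finset.sum_congr rfl fun j _ => ?_
    rw [← Complex.ofReal_pow, Complex.ofReal_re]
  rw [schattenTwoNorm, h, Real.sq_sqrt (by positivity)]

/-- The squared distance of a qubit state from the maximally mixed state. -/
theorem sum_norm_sub_half_sq {A : Matrix (Fin 2) (Fin 2) ℂ} (hA : A.IsHermitian)
    (htr : A.trace = 1) :
    ∑ a, ∑ b, ‖A a b - ((2⁻¹ : ℂ) • (1 : Matrix (Fin 2) (Fin 2) ℂ)) a b‖ ^ 2 =
      (∑ a, ∑ b, A a b * A b a).re - 1 / 2 := by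
  have h10 := hA.apply 1 0
  have h00 := congrArg Complex.im (hA.apply 0 0)
  have h11 := congrArg Complex.im (hA.apply 1 1)
  have ht := congrArg Complex.re htr
  simp only [RCLike.star_def, Complex.conj_im, Matrix.trace_fin_two, Complex.add_re,
    Complex.one_re] at h00 h11 ht
  have h00' : (A 0 0).im = 0 := by linarith
  have h11' : (A 1 1).im = 0 := by linarith
  simp only [Fin.sum_univ_two, ← h10, Complex.sq_norm, Complex.normSq_apply, Matrix.smul_apply,
    Matrix.one_apply, RCLike.star_def]
  norm_num [h00', h11']
  linear_combination -ht

/-- Entrywise `|u - v|² ≤ 2 |u|² + 2 |v|²`, after centring both matrices at half the identity. This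
decouples the two inputs. -/
theorem schattenTwoNorm_sub_sq_le {A B : Matrix (Fin 2) (Fin 2) ℂ} (hA : A.IsHermitian)
    (hB : B.IsHermitian) (hA1 : A.trace = 1) (hB1 : B.trace = 1) :
    schattenTwoNorm (A - B) ^ 2 ≤ 2 * ((∑ a, ∑ b, A a b * A b a).re - 1 / 2) +
      2 * ((∑ a, ∑ b, B a b * B b a).re - 1 / 2) := by
  rw [schattenTwoNorm_sq, ← sum_norm_sub_half_sq hA hA1, ← sum_norm_sub_half_sq hB hB1]
  simp only [Finset.mul_sum, ← Finset.sum_add_distrib]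
  refine Finset.sum_le_sum fun a _ => Finset.sum_le_sum fun b _ => ?_
  generalize ((2⁻¹ : ℂ) • (1 : Matrix (Fin 2) (Fin 2) ℂ)) a b = c
  have h := norm_sub_le (A a b - c) (B a b - c)
  rw [sub_sub_sub_cancel_right] at h
  have h0 := norm_nonneg (A a b - B a b)
  rw [Matrix.sub_apply]
  nlinarith [sq_nonneg (‖A a b - c‖ - ‖B a b - c‖)]

end Reduced

/-! ### Moments of the kernels and the concentration bounds. -/

section Kernel

variable {𝒳 : Type*} {n : ℕ} {ρ : Op n}

theorem isState_encode (U : 𝒳 → UGroup n) (hρ : IsState ρ) (x : 𝒳) : IsState (encode U ρ x) :=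
  isState_rotate hρ (U x)

theorem ofReal_fidelityKernel (U : 𝒳 → UGroup n) (hρ : IsState ρ) (x x' : 𝒳) :
    (fidelityKernel U ρ x x' : ℂ) = (encode U ρ x * encode U ρ x').trace := by
  refine Complex.conj_eq_iff_re.mp ?_
  rw [← RCLike.star_def, ← Matrix.trace_conjTranspose, Matrix.conjTranspose_mul,
    (isState_encode U hρ x).1.isHermitian.eq, (isState_encode U hρ x').1.isHermitian.eq,
    Matrix.trace_mul_comm]

/-- From `(Tr X)² = Tr (X ⊗ X)`; each summand separates `x` from `x'`, so its integral factors. -/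
theorem ofReal_fidelityKernel_sq (U : 𝒳 → UGroup n) (hρ : IsState ρ) (x x' : 𝒳) :
    ((fidelityKernel U ρ x x' ^ 2 : ℝ) : ℂ) = ∑ p : Bits n × Bits n, ∑ q : Bits n × Bits n,
      (encode U ρ x p.1 q.1 * encode U ρ x p.2 q.2) *
        (encode U ρ x' q.1 p.1 * encode U ρ x' q.2 p.2) := by
  rw [Complex.ofReal_pow, ofReal_fidelityKernel U hρ, sq, ← Matrix.trace_kronecker,
    Matrix.mul_kronecker_mul]
  simp only [Matrix.trace, Matrix.diag_apply, Matrix.mul_apply, Matrix.kroneckerMap_apply]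

variable [MeasurableSpace 𝒳] {μ : Measure 𝒳} {U : 𝒳 → UGroup n}

theorem deviationProb_le [IsProbabilityMeasure μ] {κ : 𝒳 → 𝒳 → ℝ}
    (hκ : MemLp (fun p : 𝒳 × 𝒳 => κ p.1 p.2) 2 (μ.prod μ)) {C δ : ℝ}
    (hC : ProbabilityTheory.variance (fun p : 𝒳 × 𝒳 => κ p.1 p.2) (μ.prod μ) ≤ C) (hδ : 0 < δ) :
    deviationProb μ κ δ ≤ C / δ ^ 2 := by
  have h := ProbabilityTheory.meas_ge_le_variance_div_sq hκ hδ
  have h0 := ProbabilityTheory.variance_nonneg (fun p : 𝒳 × 𝒳 => κ p.1 p.2) (μ.prod μ)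
  calc deviationProb μ κ δ
      ≤ ProbabilityTheory.variance (fun p : 𝒳 × 𝒳 => κ p.1 p.2) (μ.prod μ) / δ ^ 2 :=
        ENNReal.toReal_le_of_le_ofReal (by positivity) h
    _ ≤ C / δ ^ 2 := by gcongr

theorem measurable_encode_apply (hU : Measurable U) (ρ : Op n) (i k : Bits n) :
    Measurable fun x => encode U ρ x i k :=
  (continuous_rotate_apply ρ i k).measurable.comp hU

theorem integrable_encode_mul [IsFiniteMeasure μ] (hU : Measurable U) (ρ : Op n)
    (i j k l : Bits n) : Integrable (fun x => encode U ρ x i k * encode U ρ x j l) μ :=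
  (integrable_rotate_mul (μ.map U) ρ i j k l).comp_measurable hU

theorem twirl_map_apply (hU : Measurable U) (ρ : Op n) (p q : Bits n × Bits n) :
    twirl (μ.map U) ρ p q = ∫ x, encode U ρ x p.1 q.1 * encode U ρ x p.2 q.2 ∂μ := by
  rw [twirl_apply, integral_map hU.aemeasurable
    (continuous_rotate_mul ρ _ _ _ _).aestronglyMeasurable]
  rfl

theorem integrable_ofReal_fidelityKernel_sq [IsProbabilityMeasure μ] (hU : Measurable U)
    (hρ : IsState ρ) :
    Integrable (fun p : 𝒳 × 𝒳 => ((fidelityKernel U ρ p.1 p.2 ^ 2 : ℝ) : ℂ)) (μ.prod μ) := by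
  simp only [ofReal_fidelityKernel_sq U hρ]
  exact integrable_finsetSum _ fun p _ => integrable_finsetSum _ fun q _ =>
    (integrable_encode_mul hU ρ _ _ _ _).mul_prod (integrable_encode_mul hU ρ _ _ _ _)

theorem integral_fidelityKernel_sq [IsProbabilityMeasure μ] (hU : Measurable U)
    (hρ : IsState ρ) :
    ∫ p : 𝒳 × 𝒳, fidelityKernel U ρ p.1 p.2 ^ 2 ∂(μ.prod μ) =
      (twirl (μ.map U) ρ * twirl (μ.map U) ρ).trace.re := by
  have h : ∫ p : 𝒳 × 𝒳, ((fidelityKernel U ρ p.1 p.2 ^ 2 : ℝ) : ℂ) ∂(μ.prod μ) =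
      (twirl (μ.map U) ρ * twirl (μ.map U) ρ).trace := by
    have hi : ∀ p q : Bits n × Bits n, Integrable (fun z : 𝒳 × 𝒳 =>
        (encode U ρ z.1 p.1 q.1 * encode U ρ z.1 p.2 q.2) *
          (encode U ρ z.2 q.1 p.1 * encode U ρ z.2 q.2 p.2)) (μ.prod μ) := fun p q =>
      (integrable_encode_mul hU ρ _ _ _ _).mul_prod (integrable_encode_mul hU ρ _ _ _ _)
    simp only [ofReal_fidelityKernel_sq U hρ, Matrix.trace, Matrix.diag_apply, Matrix.mul_apply]
    rw [integral_finsetSum _ fun p _ => integrable_finsetSum _ fun q _ => hi p q]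
    refine Finset.sum_congr rfl fun p _ => ?_
    rw [integral_finsetSum _ fun q _ => hi p q]
    refine Finset.sum_congr rfl fun q _ => ?_
    rw [integral_prod_mul (fun x => encode U ρ x p.1 q.1 * encode U ρ x p.2 q.2)
      (fun x => encode U ρ x q.1 p.1 * encode U ρ x q.2 p.2), twirl_map_apply hU,
      twirl_map_apply hU]
  rw [← h, integral_complex_ofReal, Complex.ofReal_re]

theorem measurable_fidelityKernel (hU : Measurable U) (ρ : Op n) :
    Measurable fun p : 𝒳 × 𝒳 => fidelityKernel U ρ p.1 p.2 := by
  have h := measurable_encode_apply hU ρ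
  simp only [fidelityKernel, Matrix.trace, Matrix.diag_apply, Matrix.mul_apply]
  exact Complex.measurable_re.comp (Finset.measurable_fun_sum _ fun i _ =>
    Finset.measurable_fun_sum _ fun j _ =>
      ((h i j).comp measurable_fst).mul ((h j i).comp measurable_snd))

theorem deviationProb_fidelityKernel_le [IsProbabilityMeasure μ] (hn : 1 ≤ n)
    (hU : Measurable U) (hρ : IsState ρ) {δ : ℝ} (hδ : 0 < δ) :
    deviationProb μ (fidelityKernel U ρ) δ ≤
      (betaHaar n + expressivity (μ.map U) ρ ^ 2) / δ ^ 2 := by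
  have hm := (measurable_fidelityKernel hU ρ).aestronglyMeasurable (μ := μ.prod μ)
  have : IsProbabilityMeasure (μ.map U) := Measure.isProbabilityMeasure_map hU.aemeasurable
  refine deviationProb_le ((memLp_two_iff_integrable_sq hm).mpr ?_)
    ((ProbabilityTheory.variance_le_expectation_sq hm).trans ?_) hδ
  · exact (integrable_ofReal_fidelityKernel_sq hU hρ).re
  · exact (integral_fidelityKernel_sq hU hρ).trans_le (re_trace_twirl_mul_self_le hn hρ _)

theorem measurable_projectedKernel (γ : ℝ) (hU : Measurable U) (ρ : Op n) :
    Measurable fun p : 𝒳 × 𝒳 => projectedKernel γ U ρ p.1 p.2 := by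
  have h : ∀ k a b, Measurable fun x => reduced k (encode U ρ x) a b := fun k a b =>
    Finset.measurable_fun_sum _ fun z _ => measurable_encode_apply hU ρ _ _
  simp only [projectedKernel, schattenTwoNorm_sq, Matrix.sub_apply]
  exact Real.measurable_exp.comp ((Finset.measurable_fun_sum _ fun k _ =>
    Finset.measurable_fun_sum _ fun a _ => Finset.measurable_fun_sum _ fun b _ =>
      (((h k a b).comp measurable_fst).sub ((h k a b).comp measurable_snd)).norm.pow_const
        2).const_mul _)

theorem integrable_reduced_mul [IsProbabilityMeasure μ] (hU : Measurable U) (ρ : Op n)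
    (k : Fin n) : Integrable (fun x => ∑ a, ∑ b, reduced k (encode U ρ x) a b *
      reduced k (encode U ρ x) b a) μ := by
  simp only [sum_reduced_mul]
  exact integrable_finsetSum _ fun p _ => integrable_encode_mul hU ρ _ _ _ _

theorem integral_reduced_mul [IsProbabilityMeasure μ] (hU : Measurable U) (ρ : Op n)
    (k : Fin n) : ∫ x, ∑ a, ∑ b, reduced k (encode U ρ x) a b *
      reduced k (encode U ρ x) b a ∂μ = (exchangeOp k * twirl (μ.map U) ρ).trace := by
  simp only [sum_reduced_mul]
  rw [integral_finsetSum _ fun p _ => integrable_encode_mul hU ρ _ _ _ _, trace_exchangeOp_mul,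
    ← Equiv.sum_comp (exchange_involutive k).toPerm]
  simp only [Function.Involutive.coe_toPerm, (exchange_involutive k) _, twirl_map_apply hU]

theorem deviationProb_projectedKernel_le [IsProbabilityMeasure μ] (hn : 1 ≤ n)
    (hU : Measurable U) (hρ : IsState ρ) {γ : ℝ} (hγ : 0 < γ) {δ : ℝ} (hδ : 0 < δ) :
    deviationProb μ (projectedKernel γ U ρ) δ ≤
      4 * γ * n * (betaTildeHaar n + expressivity (μ.map U) ρ) / δ ^ 2 := by
  have hm := (measurable_projectedKernel γ hU ρ).aestronglyMeasurable (μ := μ.prod μ)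
  have : IsProbabilityMeasure (μ.map U) := Measure.isProbabilityMeasure_map hU.aemeasurable
  have hS : ∀ x x', 0 ≤ γ * ∑ k : Fin n,
      schattenTwoNorm (reduced k (encode U ρ x) - reduced k (encode U ρ x')) ^ 2 :=
    fun x x' => by positivity
  have hle : ∀ x x', projectedKernel γ U ρ x x' ≤ 1 := fun x x' =>
    Real.exp_le_one_iff.mpr (by linarith [hS x x'])
  have hpos : ∀ x x', 0 < projectedKernel γ U ρ x x' := fun x x' => Real.exp_pos _
  set f : Fin n → 𝒳 → ℝ := fun k x => (∑ a, ∑ b, reduced k (encode U ρ x) a b *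
      reduced k (encode U ρ x) b a).re - 1 / 2 with hf
  have hfi : ∀ k, Integrable (f k) μ := fun k =>
    (integrable_reduced_mul hU ρ k).re.sub (integrable_const _)
  have hfint : ∀ k, ∫ x, f k x ∂μ ≤ betaTildeHaar n + expressivity (μ.map U) ρ := by
    intro k
    have hre : ∫ x, (∑ a, ∑ b, reduced k (encode U ρ x) a b *
        reduced k (encode U ρ x) b a).re ∂μ = (exchangeOp k * twirl (μ.map U) ρ).trace.re := by
      rw [← integral_reduced_mul hU ρ k]
      exact integral_re (integrable_reduced_mul hU ρ k)
    have h := re_trace_exchangeOp_mul_twirl_le hn hρ (μ.map U) k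
    have hsub : ∫ x, f k x ∂μ = ∫ x, (∑ a, ∑ b, reduced k (encode U ρ x) a b *
        reduced k (encode U ρ x) b a).re ∂μ - ∫ _, 1 / 2 ∂μ :=
      integral_sub (integrable_reduced_mul hU ρ k).re (integrable_const _)
    rw [hsub, hre, integral_const, probReal_univ, one_smul]
    linarith
  have hgi : ∀ k, Integrable (fun p : 𝒳 × 𝒳 => 2 * f k p.1 + 2 * f k p.2) (μ.prod μ) := fun k =>
    (((hfi k).comp_fst μ).const_mul 2).add (((hfi k).comp_snd μ).const_mul 2)
  have hgint : ∀ k, ∫ p : 𝒳 × 𝒳, (2 * f k p.1 + 2 * f k p.2) ∂(μ.prod μ) =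
      4 * ∫ x, f k x ∂μ := by
    intro k
    rw [integral_add (((hfi k).comp_fst μ).const_mul 2) (((hfi k).comp_snd μ).const_mul 2),
      integral_const_mul, integral_const_mul, integral_fun_fst, integral_fun_snd]
    simp only [probReal_univ, one_smul]
    ring
  have hbound : ∀ x x', (1 - projectedKernel γ U ρ x x') ^ 2 ≤
      γ * ∑ k, (2 * f k x + 2 * f k x') := by
    intro x x'
    have h₁ := Real.add_one_le_exp (-γ * ∑ k : Fin n,
      schattenTwoNorm (reduced k (encode U ρ x) - reduced k (encode U ρ x')) ^ 2)
    change _ ≤ projectedKernel γ U ρ x x' at h₁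
    have h₂ : γ * ∑ k : Fin n,
        schattenTwoNorm (reduced k (encode U ρ x) - reduced k (encode U ρ x')) ^ 2 ≤
        γ * ∑ k, (2 * f k x + 2 * f k x') := by
      gcongr with k
      have hx := isState_encode U hρ x
      have hx' := isState_encode U hρ x'
      exact schattenTwoNorm_sub_sq_le (isHermitian_reduced hx.1.isHermitian k)
        (isHermitian_reduced hx'.1.isHermitian k) (by rw [trace_reduced, hx.2])
        (by rw [trace_reduced, hx'.2])
    -- Since `0 < κ ≤ 1`, `(1 - κ)² ≤ 1 - κ`, and `h₁`, `h₂` bound the latter.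
    nlinarith [hle x x', hpos x x']
  refine deviationProb_le (MemLp.of_bound hm 1 (.of_forall fun p => ?_)) ?_ hδ
  · rw [Real.norm_of_nonneg (hpos _ _).le]
    exact hle _ _
  -- Centring at `1` rather than `0`: it is `1 - κ` that is small when the reduced states are nearly
  -- mixed.
  rw [← ProbabilityTheory.variance_const_sub hm 1]
  refine (ProbabilityTheory.variance_le_expectation_sq (aestronglyMeasurable_const.sub hm)).trans ?_
  calc ∫ p : 𝒳 × 𝒳, (1 - projectedKernel γ U ρ p.1 p.2) ^ 2 ∂(μ.prod μ)
      ≤ ∫ p : 𝒳 × 𝒳, γ * ∑ k, (2 * f k p.1 + 2 * f k p.2) ∂(μ.prod μ) :=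
        integral_mono_of_nonneg (.of_forall fun p => sq_nonneg _)
          ((integrable_finsetSum _ fun k _ => hgi k).const_mul γ)
          (.of_forall fun p => hbound p.1 p.2)
    _ = γ * ∑ k, 4 * ∫ x, f k x ∂μ := by
        rw [integral_const_mul, integral_finsetSum _ fun k _ => hgi k]
        simp only [hgint]
    _ ≤ γ * ∑ _k : Fin n, 4 * (betaTildeHaar n + expressivity (μ.map U) ρ) := by
        gcongr with k
        exact hfint k
    _ = 4 * γ * n * (betaTildeHaar n + expressivity (μ.map U) ρ) := by
        rw [Finset.sum_const, Finset.card_univ, Fintype.card_fin, nsmul_eq_mul]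
        ring

end Kernel

theorem traceNorm_nonneg {ι : Type*} [Fintype ι] [DecidableEq ι] (A : Matrix ι ι ℂ) :
    0 ≤ traceNorm A :=
  Finset.sum_nonneg fun _ _ => Real.sqrt_nonneg _

end QuantumKernel

theorem theorem1 {𝒳 : Type*} [MeasurableSpace 𝒳] (μ : Measure 𝒳) [IsProbabilityMeasure μ]
    (n : ℕ) (hn : 1 ≤ n) (U : 𝒳 → UGroup n) (hU : Measurable U)
    (ρ₀ : Op n) (hρ₀ : IsState ρ₀) (γ : ℝ) (hγ : 0 < γ) (δ : ℝ) (hδ : 0 < δ) :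
    deviationProb μ (fidelityKernel U ρ₀) δ ≤
        (betaHaar n + expressivity (μ.map U) ρ₀ *
          (expressivity (μ.map U) ρ₀ + 2 * √(betaHaar n))) / δ ^ 2 ∧
      deviationProb μ (projectedKernel γ U ρ₀) δ ≤
        4 * γ * n * (betaTildeHaar n + expressivity (μ.map U) ρ₀) / δ ^ 2 := by
  refine ⟨(deviationProb_fidelityKernel_le hn hU hρ₀ hδ).trans ?_,
    deviationProb_projectedKernel_le hn hU hρ₀ hγ hδ⟩
  have hε : 0 ≤ expressivity (μ.map U) ρ₀ := traceNorm_nonneg _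
  -- The bound already obtained is `β + ε²`; the term `2 ε √β` is pure slack.
  have hs : 0 ≤ expressivity (μ.map U) ρ₀ * √(betaHaar n) := by positivity
  gcongr
  nlinarith
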